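/- **Definitions.** A *subordination* between boolean algebras $A,B$ is a relation $S\subseteq A\times B$ such that $0\,S\,0$ and $1\,S\,1$; $a,b\,S\,c$ implies $(a\vee b)\,S\,c$; $a\,S\,c,d$ implies $a\,S\,(c\wedge d)$; and $a\le b\,S\,c\le d$ implies $a\,S\,d$. An *$\mathsf{S5}$-subordination algebra* is a pair $\mathbf B=(B,S)$ with $B$ a boolean algebra and $S$ a subordination on $B$ such that $a\,S\,b$ implies $a\le b$; $a\,S\,b$ implies $\neg b\,S\,\neg a$; and $a\,S\,b$ implies $a\,S\,c\,S\,b$ for some $c\in B$. It is a *de Vries algebra* if $B$ is complete and for each $a\ne 0$ there is $b\neq 0$ with $b\,S\,a$. A subordination $T\colon (B_1,S_1)\to(B_2,S_2)$ is *compatible* if $S_2\circ T=T=T\circ S_1$. Let $\mathsf{SubS5^S}$ be the category of $\mathsf{S5}$-subordination algebras and compatible subordinations, with relation composition as composition and with $S$ as the identity on $(B,S)$. Let $\Delta\colon\mathsf{DeV^S}\hookrightarrow\mathsf{SubS5^S}$ be the inclusion of the full subcategory of de Vries algebras. In a frame $L$ let $a^*$ be the pseudocomplement of $a$, and write $a\prec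 b$ if $a^*\vee b=1$. $L$ is *compact* if $1$ is a compact element, and *regular* if $a=\bigvee\{x\mid x\prec a\}$ for all $a\in L$. A *preframe homomorphism* is a map between frames that preserves finite meets and directed joins (directed sets being nonempty). Let $\mathsf{KRFrm^P}$ be the category of compact regular frames and preframe homomorphisms. A *round ideal* of $\mathbf B=(B,S)$ is an ideal $I$ of $B$ such that each $a\in I$ satisfies $a\,S\,b$ for some $b\in I$. The contravariant functor $\mathcal{RI}\colon\mathsf{SubS5^S}\to\mathsf{KRFrm^P}$ sends $\mathbf B$ to the set of its round ideals ordered by inclusion, and $T\colon\mathbf B_1\to\mathbf B_2$ to $\mathcal{RI}(T)\colon\mathcal{RI}(\mathbf B_2)\to\mathcal{RI}(\mathbf B_1)$, $I\mapsto T^{-1}[I]=\{a\mid a\,T\,b\text{ for some }b\in I\}$. The contravariant functor $\mathfrak B\colon\mathsf{KRFrm^P}\to\mathsf{DeV^S}$ sends $L$ to $(\mathfrak BL,\prec)$, where $\mathfrak BL=\{a\in L\mid a=a^{**}\}$ is its booleanization and $\prec$ is the restriction of the relation $\prec$ of $L$, and sends $\Box\colon L\to M$ to the relation $\mathfrak B(\Box)\colon\mathfrak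 BM\to\mathfrak BL$ given by $b\mathrel{\mathfrak B(\Box)}a\iff b\prec\Box a$. Let $\mathcal{NI}=\mathfrak B\circ\mathcal{RI}\colon\mathsf{SubS5^S}\to\mathsf{DeV^S}$. **Theorem.** 1. $\mathcal{RI}$ and $\Delta\circ\mathfrak B$ form a dual equivalence between $\mathsf{SubS5^S}$ and $\mathsf{KRFrm^P}$. 2. $\mathcal{RI}\circ\Delta$ and $\mathfrak B$ form a dual equivalence between $\mathsf{DeV^S}$ and $\mathsf{KRFrm^P}$. Moreover, $\mathcal{NI}$ and $\Delta$ form an equivalence between $\mathsf{SubS5^S}$ and $\mathsf{DeV^S}$, and the resulting triangle, with sides $\mathcal{RI}\colon\mathsf{SubS5^S}\to\mathsf{KRFrm^P}$, $\mathfrak B\colon\mathsf{KRFrm^P}\to\mathsf{DeV^S}$ and the pair $\mathcal{NI}\colon\mathsf{SubS5^S}\leftrightarrows\mathsf{DeV^S}:\!\Delta$, commutes up to natural isomorphism: $\mathfrak B\circ\mathcal{RI}\cong\mathcal{NI}$, $\Delta\circ\mathfrak B\circ\mathcal{RI}\cong 1_{\mathsf{SubS5^S}}$, $\mathfrak B\circ\mathcal{RI}\circ\Delta\cong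 1_{\mathsf{DeV^S}}$, $\mathcal{RI}\circ\Delta\circ\mathfrak B\cong 1_{\mathsf{KRFrm^P}}$, $\Delta\circ\mathcal{NI}\cong 1_{\mathsf{SubS5^S}}$ and $\mathcal{NI}\circ\Delta\cong 1_{\mathsf{DeV^S}}$. -/

import Mathlib

universe u

namespace S5Sub

open CategoryTheory

/-! Subordinations and S5-subordination algebras -/

/-- A subordination between boolean algebras. -/
structure IsSubordination {A B : Type*} [BooleanAlgebra A] [BooleanAlgebra B]
    (S : A → B → Prop) : Prop where
  bot_bot : S ⊥ ⊥
  top_top : S ⊤ ⊤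
  sup_left : ∀ a b c, S a c → S b c → S (a ⊔ b) c
  inf_right : ∀ a c d, S a c → S a d → S a (c ⊓ d)
  mono : ∀ a b c d, a ≤ b → S b c → c ≤ d → S a d

/-- An S5-subordination on a boolean algebra. -/
structure IsS5Subordination {B : Type*} [BooleanAlgebra B] (S : B → B → Prop) : Prop
    extends IsSubordination S where
  le_of_rel : ∀ a b, S a b → a ≤ b
  compl_rel : ∀ a b, S a b → S bᶜ aᶜ
  exists_between : ∀ a b, S a b → ∃ c, S a c ∧ S c b

/-- S5-subordination algebras: the objects of `SubS5^S`. -/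
structure SubS5S : Type (u + 1) where
  carrier : Type u
  [boolean : BooleanAlgebra carrier]
  rel : carrier → carrier → Prop
  isS5 : IsS5Subordination rel

attribute [instance] SubS5S.boolean

/-- `T : B₁ → B₂` is a compatible subordination: `T` is a subordination and
`S₂ ∘ T = T = T ∘ S₁`. (`Relation.Comp R R'` relates `a` to `c` iff `R a b` and `R' b c`
for some `b`.) -/
structure IsCompatibleSubordination (B₁ B₂ : SubS5S.{u})
    (T : B₁.carrier → B₂.carrier → Prop) : Prop extends IsSubordination T where
  comp_right : Relation.Comp T B₂.rel = T
  comp_left : Relation.Comp B₁.rel T = T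

/-- Morphisms of `SubS5^S`: compatible subordinations. -/
@[ext]
structure SubS5S.Hom (B₁ B₂ : SubS5S.{u}) : Type u where
  rel : B₁.carrier → B₂.carrier → Prop
  compat : IsCompatibleSubordination B₁ B₂ rel

theorem SubS5S.comp_rel_self (B : SubS5S.{u}) : Relation.Comp B.rel B.rel = B.rel := by
  funext a b
  refine propext ⟨?_, fun h => B.isS5.exists_between a b h⟩
  rintro ⟨c, hac, hcb⟩
  exact B.isS5.mono a c b b (B.isS5.le_of_rel a c hac) hcb le_rfl

/-- The identity morphism of `(B, S)` is `S`. -/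
def SubS5S.Hom.id (B : SubS5S.{u}) : SubS5S.Hom B B where
  rel := B.rel
  compat :=
    { toIsSubordination := B.isS5.toIsSubordination
      comp_right := B.comp_rel_self
      comp_left := B.comp_rel_self }

/-- Composition of morphisms is composition of relations. -/
def SubS5S.Hom.comp {B₁ B₂ B₃ : SubS5S.{u}} (T : SubS5S.Hom B₁ B₂) (U : SubS5S.Hom B₂ B₃) :
    SubS5S.Hom B₁ B₃ where
  rel := Relation.Comp T.rel U.rel
  compat :=
    { bot_bot := ⟨⊥, T.compat.bot_bot, U.compat.bot_bot⟩
      top_top := ⟨⊤, T.compat.top_top, U.compat.top_top⟩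
      sup_left := by
        rintro a b c ⟨x, hax, hxc⟩ ⟨y, hby, hyc⟩
        exact ⟨x ⊔ y, T.compat.sup_left _ _ _ (T.compat.mono _ _ _ _ le_rfl hax le_sup_left)
          (T.compat.mono _ _ _ _ le_rfl hby le_sup_right), U.compat.sup_left _ _ _ hxc hyc⟩
      inf_right := by
        rintro a c d ⟨x, hax, hxc⟩ ⟨y, hay, hyd⟩
        exact ⟨x ⊓ y, T.compat.inf_right _ _ _ hax hay, U.compat.inf_right _ _ _
          (U.compat.mono _ _ _ _ inf_le_left hxc le_rfl)
          (U.compat.mono _ _ _ _ inf_le_right hyd le_rfl)⟩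
      mono := by
        rintro a b c d hab ⟨x, hbx, hxc⟩ hcd
        exact ⟨x, T.compat.mono _ _ _ _ hab hbx le_rfl, U.compat.mono _ _ _ _ le_rfl hxc hcd⟩
      comp_right := by rw [Relation.comp_assoc, U.compat.comp_right]
      comp_left := by rw [← Relation.comp_assoc, T.compat.comp_left] }

/-- The category `SubS5^S` of S5-subordination algebras and compatible subordinations. -/
instance : Category.{u} SubS5S.{u} where
  Hom := SubS5S.Hom
  id := SubS5S.Hom.id
  comp := SubS5S.Hom.comp
  id_comp T := SubS5S.Hom.ext T.compat.comp_left
  comp_id T := SubS5S.Hom.ext T.compat.comp_right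
  assoc _ _ _ := SubS5S.Hom.ext Relation.comp_assoc

/-- De Vries algebras: S5-subordination algebras on a complete boolean algebra in which every
nonzero `a` has a nonzero `b` with `b S a`. -/
def IsDeVries : ObjectProperty SubS5S.{u} := fun B =>
  (∀ a : B.carrier, a ≠ ⊥ → ∃ b : B.carrier, b ≠ ⊥ ∧ B.rel b a) ∧
    ∀ s : Set B.carrier, ∃ x, IsLUB s x

/-- `DeV^S`, the full subcategory of `SubS5^S` of de Vries algebras. -/
abbrev DeVS : Type (u + 1) := IsDeVries.{u}.FullSubcategory

/-- The inclusion functor `Δ : DeV^S ⥤ SubS5^S`. -/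
abbrev Δ : DeVS.{u} ⥤ SubS5S.{u} := IsDeVries.ι

/-! Compact regular frames and preframe homomorphisms -/

/-- `a` is well-inside `b`; in a frame `aᶜ` is the pseudocomplement of `a`. -/
def WellInside {L : Type*} [Order.Frame L] (a b : L) : Prop := aᶜ ⊔ b = ⊤

/-- Compact regular frames: the objects of `KRFrm^P`. -/
structure KRFrmP : Type (u + 1) where
  carrier : Type u
  [frame : Order.Frame carrier]
  compact : IsCompactElement (⊤ : carrier)
  regular : ∀ a : carrier, a = sSup {x | WellInside x a}

attribute [instance] KRFrmP.frame

/-- Preframe homomorphisms: maps preserving finite meets and (nonempty) directed joins. -/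
@[ext]
structure PreframeHom (L M : Type*) [Order.Frame L] [Order.Frame M] where
  toFun : L → M
  map_top : toFun ⊤ = ⊤
  map_inf : ∀ a b, toFun (a ⊓ b) = toFun a ⊓ toFun b
  scott : ScottContinuous toFun

/-- The category `KRFrm^P` of compact regular frames and preframe homomorphisms. -/
instance : Category.{u} KRFrmP.{u} where
  Hom L M := PreframeHom L.carrier M.carrier
  id _ := ⟨fun a => a, rfl, fun _ _ => rfl, ScottContinuous.id⟩
  comp f g := ⟨fun a => g.toFun (f.toFun a), by rw [f.map_top, g.map_top],
    fun a b => by rw [f.map_inf, g.map_inf], f.scott.comp g.scott⟩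

/-! The functor of round ideals -/

/-- Round ideals of an S5-subordination algebra, ordered by inclusion. -/
def RoundIdeal (B : SubS5S.{u}) : Type u :=
  {I : Order.Ideal B.carrier // ∀ a ∈ I, ∃ b ∈ I, B.rel a b}

namespace RoundIdeal

variable {B : SubS5S.{u}}

instance : SetLike (RoundIdeal B) B.carrier where
  coe I := I.1
  coe_injective _ _ h := Subtype.ext (SetLike.coe_injective h)

instance : PartialOrder (RoundIdeal B) := PartialOrder.lift Subtype.val Subtype.val_injective

theorem le_def {I J : RoundIdeal B} : I ≤ J ↔ ∀ a ∈ I, a ∈ J := Iff.rfl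

theorem bot_mem (I : RoundIdeal B) : ⊥ ∈ I := I.1.bot_mem

theorem sup_mem (I : RoundIdeal B) {a b : B.carrier} (ha : a ∈ I) (hb : b ∈ I) : a ⊔ b ∈ I :=
  Order.Ideal.sup_mem (s := I.1) ha hb

theorem mem_of_le (I : RoundIdeal B) {a b : B.carrier} (h : a ≤ b) (hb : b ∈ I) : a ∈ I :=
  I.1.lower h hb

theorem round (I : RoundIdeal B) {a : B.carrier} (ha : a ∈ I) : ∃ b ∈ I, B.rel a b := I.2 a ha

theorem finset_sup_mem (I : RoundIdeal B) (t : Finset B.carrier) (h : ∀ x ∈ t, x ∈ I) :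
    t.sup id ∈ I :=
  Finset.sup_induction I.bot_mem (fun _ ha _ hb => I.sup_mem ha hb) h

/-- A round ideal from its set of elements. -/
def mk' (s : Set B.carrier) (bot : ⊥ ∈ s) (sup : ∀ a ∈ s, ∀ b ∈ s, a ⊔ b ∈ s)
    (lower : ∀ a b, a ≤ b → b ∈ s → a ∈ s) (round : ∀ a ∈ s, ∃ b ∈ s, B.rel a b) :
    RoundIdeal B :=
  ⟨{ carrier := s
     lower' := fun a b h ha => lower b a h ha
     nonempty' := ⟨⊥, bot⟩
     directed' := fun a ha b hb => ⟨a ⊔ b, sup a ha b hb, le_sup_left, le_sup_right⟩ }, round⟩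

/-- The join of round ideals is the ideal generated by their union. -/
instance : SupSet (RoundIdeal B) where
  sSup 𝒮 := mk'
    {a | ∃ t : Finset B.carrier, (∀ x ∈ t, ∃ I ∈ 𝒮, x ∈ I) ∧ a ≤ t.sup id}
    ⟨∅, by simp, bot_le⟩
    (by
      classical
      rintro a ⟨t, ht, hat⟩ b ⟨t', ht', hbt'⟩
      refine ⟨t ∪ t', fun x hx => ?_, ?_⟩
      · rcases Finset.mem_union.1 hx with hx | hx
        · exact ht x hx
        · exact ht' x hx
      · rw [Finset.sup_union]
        exact sup_le_sup hat hbt')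
    (by
      rintro a b hab ⟨t, ht, hbt⟩
      exact ⟨t, ht, hab.trans hbt⟩)
    (by
      classical
      rintro a ⟨t, ht, hat⟩
      have key : ∃ t' : Finset B.carrier, (∀ x ∈ t', ∃ I ∈ 𝒮, x ∈ I) ∧
          B.rel (t.sup id) (t'.sup id) := by
        clear hat
        induction t using Finset.induction_on with
        | empty => exact ⟨∅, by simp, B.isS5.bot_bot⟩
        | insert x t hx ih =>
          obtain ⟨t', ht', hr⟩ := ih fun y hy => ht y (Finset.mem_insert_of_mem hy)
          obtain ⟨I, hI, hxI⟩ := ht x (Finset.mem_insert_self x t)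
          obtain ⟨y, hyI, hxy⟩ := I.round hxI
          refine ⟨insert y t', fun z hz => ?_, ?_⟩
          · rcases Finset.mem_insert.1 hz with rfl | hz
            · exact ⟨I, hI, hyI⟩
            · exact ht' z hz
          · rw [Finset.sup_insert, Finset.sup_insert]
            exact B.isS5.sup_left _ _ _ (B.isS5.mono _ _ _ _ le_rfl hxy le_sup_left)
              (B.isS5.mono _ _ _ _ le_rfl hr le_sup_right)
      obtain ⟨t', ht', hr⟩ := key
      exact ⟨t'.sup id, ⟨t', ht', le_rfl⟩, B.isS5.mono _ _ _ _ hat hr le_rfl⟩)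

theorem mem_sSup {𝒮 : Set (RoundIdeal B)} {a : B.carrier} :
    a ∈ sSup 𝒮 ↔ ∃ t : Finset B.carrier, (∀ x ∈ t, ∃ I ∈ 𝒮, x ∈ I) ∧ a ≤ t.sup id := Iff.rfl

theorem isLUB_sSup (𝒮 : Set (RoundIdeal B)) : IsLUB 𝒮 (sSup 𝒮) := by
  constructor
  · intro I hI a ha
    exact mem_sSup.2 ⟨{a}, by simpa using ⟨I, hI, ha⟩, by simp⟩
  · rintro J hJ a ⟨t, ht, hat⟩
    refine J.mem_of_le hat (J.finset_sup_mem t fun x hx => ?_)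
    obtain ⟨I, hI, hxI⟩ := ht x hx
    exact hJ hI hxI

/-- Binary meets of round ideals are intersections. -/
instance : Min (RoundIdeal B) where
  min I J := mk' {a | a ∈ I ∧ a ∈ J} ⟨I.bot_mem, J.bot_mem⟩
    (fun _ ha _ hb => ⟨I.sup_mem ha.1 hb.1, J.sup_mem ha.2 hb.2⟩)
    (fun _ _ h hb => ⟨I.mem_of_le h hb.1, J.mem_of_le h hb.2⟩)
    (by
      rintro a ⟨haI, haJ⟩
      obtain ⟨b, hb, hab⟩ := I.round haI
      obtain ⟨c, hc, hac⟩ := J.round haJ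
      exact ⟨b ⊓ c, ⟨I.mem_of_le inf_le_left hb, J.mem_of_le inf_le_right hc⟩,
        B.isS5.inf_right _ _ _ hab hac⟩)

/-- The greatest round ideal is the whole algebra. -/
instance : Top (RoundIdeal B) where
  top := mk' Set.univ trivial (fun _ _ _ _ => trivial) (fun _ _ _ _ => trivial)
    (fun _ _ => ⟨⊤, trivial, B.isS5.mono _ _ _ _ le_top B.isS5.top_top le_rfl⟩)

instance : CompleteLattice (RoundIdeal B) :=
  { completeLatticeOfSup (RoundIdeal B) isLUB_sSup with
    top := ⊤
    le_top := fun _ _ _ => trivial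
    inf := fun I J => I ⊓ J
    inf_le_left := fun _ _ _ h => h.1
    inf_le_right := fun _ _ _ h => h.2
    le_inf := fun _ _ _ h h' _ ha => ⟨h ha, h' ha⟩ }

theorem mem_inf {I J : RoundIdeal B} {a : B.carrier} : a ∈ I ⊓ J ↔ a ∈ I ∧ a ∈ J := Iff.rfl

theorem mem_top (a : B.carrier) : a ∈ (⊤ : RoundIdeal B) := trivial

instance : Order.Frame (RoundIdeal B) :=
  Order.Frame.ofMinimalAxioms
    { inf_sSup_le_iSup_inf := by
        rintro I 𝒮 a ⟨haI, t, ht, hat⟩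
        have h : a = t.sup fun x => a ⊓ x := by
          rw [← Finset.sup_inf_distrib_left, eq_comm, inf_eq_left]
          exact hat
        rw [h]
        refine Finset.sup_induction (p := fun z => z ∈ ⨆ J ∈ 𝒮, I ⊓ J) (bot_mem _)
          (fun _ ha _ hb => sup_mem _ ha hb) fun x hx => ?_
        obtain ⟨J, hJ, hxJ⟩ := ht x hx
        exact (le_iSup₂ (f := fun J (_ : J ∈ 𝒮) => I ⊓ J) J hJ)
          ⟨I.mem_of_le inf_le_left haI, J.mem_of_le inf_le_right hxJ⟩ }

/-- In a nonempty directed family, the join is the union. -/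
theorem mem_of_isLUB {D : Set (RoundIdeal B)} (hne : D.Nonempty) (hD : DirectedOn (· ≤ ·) D)
    {J : RoundIdeal B} (hJ : IsLUB D J) {a : B.carrier} (ha : a ∈ J) : ∃ I ∈ D, a ∈ I := by
  have hU : J ≤ mk' {a | ∃ I ∈ D, a ∈ I} ⟨hne.some, hne.some_mem, bot_mem _⟩
      (by
        rintro a ⟨I, hI, haI⟩ b ⟨I', hI', hbI'⟩
        obtain ⟨K, hK, h1, h2⟩ := hD I hI I' hI'
        exact ⟨K, hK, K.sup_mem (h1 haI) (h2 hbI')⟩)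
      (by
        rintro a b h ⟨I, hI, hbI⟩
        exact ⟨I, hI, I.mem_of_le h hbI⟩)
      (by
        rintro a ⟨I, hI, haI⟩
        obtain ⟨b, hb, hab⟩ := I.round haI
        exact ⟨b, ⟨I, hI, hb⟩, hab⟩) :=
    hJ.2 fun I hI a ha => ⟨I, hI, ha⟩
  exact hU ha

theorem isCompactElement_top : IsCompactElement (⊤ : RoundIdeal B) := by
  intro D J hne hD hJ hle
  obtain ⟨I, hI, h⟩ := mem_of_isLUB hne hD hJ (hle (mem_top ⊤))
  exact ⟨I, hI, fun a _ => I.mem_of_le le_top h⟩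

/-- The round ideal of all `a` with `a S b`. -/
def below (b : B.carrier) : RoundIdeal B :=
  mk' {a | B.rel a b} (B.isS5.mono _ _ _ _ le_rfl B.isS5.bot_bot bot_le)
    (fun _ ha _ hb => B.isS5.sup_left _ _ _ ha hb)
    (fun _ _ h hb => B.isS5.mono _ _ _ _ h hb le_rfl)
    (fun a ha => by
      obtain ⟨c, hac, hcb⟩ := B.isS5.exists_between a b ha
      exact ⟨c, hcb, hac⟩)

theorem mem_below {a b : B.carrier} : a ∈ below b ↔ B.rel a b := Iff.rfl

theorem wellInside_below {I : RoundIdeal B} {b : B.carrier} (hb : b ∈ I) :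
    WellInside (below b) I := by
  obtain ⟨d, hd, hbd⟩ := I.round hb
  have hK : below bᶜ ≤ (below b)ᶜ := by
    rw [le_compl_iff_disjoint_right, disjoint_iff_inf_le]
    rintro x ⟨hx, hx'⟩
    have h : x ≤ bᶜ ⊓ b := le_inf (B.isS5.le_of_rel _ _ hx) (B.isS5.le_of_rel _ _ hx')
    rw [compl_inf_self] at h
    exact mem_of_le _ h (bot_mem _)
  have hmem : dᶜ ∈ (below b)ᶜ := hK (B.isS5.compl_rel _ _ hbd)
  refine top_le_iff.1 fun x _ => mem_of_le _ (b := dᶜ ⊔ d) (by simp) ?_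
  exact sup_mem _ ((le_sup_left : (below b)ᶜ ≤ _) hmem) ((le_sup_right : I ≤ _) hd)

theorem regular (I : RoundIdeal B) : I = sSup {J | WellInside J I} := by
  refine le_antisymm (fun a ha => ?_) (sSup_le fun J hJ => ?_)
  · obtain ⟨b, hb, hab⟩ := I.round ha
    exact (le_sSup (show below b ∈ {J | WellInside J I} from wellInside_below hb)) hab
  · calc J = J ⊓ (Jᶜ ⊔ I) := by rw [show Jᶜ ⊔ I = ⊤ from hJ, inf_top_eq]
      _ ≤ I := by rw [inf_sup_left, inf_compl_self, bot_sup_eq]; exact inf_le_right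

/-- The round ideal `T⁻¹[I]`. -/
def preimage {B₁ B₂ : SubS5S.{u}} (T : B₁ ⟶ B₂) (I : RoundIdeal B₂) : RoundIdeal B₁ :=
  mk' {a | ∃ b ∈ I, T.rel a b} ⟨⊥, I.bot_mem, T.compat.bot_bot⟩
    (by
      rintro a ⟨x, hx, hax⟩ b ⟨y, hy, hby⟩
      exact ⟨x ⊔ y, I.sup_mem hx hy,
        T.compat.sup_left _ _ _ (T.compat.mono _ _ _ _ le_rfl hax le_sup_left)
          (T.compat.mono _ _ _ _ le_rfl hby le_sup_right)⟩)
    (by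
      rintro a b h ⟨x, hx, hbx⟩
      exact ⟨x, hx, T.compat.mono _ _ _ _ h hbx le_rfl⟩)
    (by
      rintro a ⟨x, hx, hax⟩
      rw [← T.compat.comp_left] at hax
      obtain ⟨b, hab, hbx⟩ := hax
      exact ⟨b, ⟨x, hx, hbx⟩, hab⟩)

theorem mem_preimage {B₁ B₂ : SubS5S.{u}} {T : B₁ ⟶ B₂} {I : RoundIdeal B₂} {a : B₁.carrier} :
    a ∈ preimage T I ↔ ∃ b ∈ I, T.rel a b := Iff.rfl

/-- `T⁻¹[-]` as a preframe homomorphism. -/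
def preimageHom {B₁ B₂ : SubS5S.{u}} (T : B₁ ⟶ B₂) :
    PreframeHom (RoundIdeal B₂) (RoundIdeal B₁) where
  toFun := preimage T
  map_top := top_le_iff.1 fun _ _ =>
    ⟨⊤, mem_top _, T.compat.mono _ _ _ _ le_top T.compat.top_top le_rfl⟩
  map_inf I J := by
    refine le_antisymm ?_ ?_
    · rintro a ⟨x, ⟨hxI, hxJ⟩, hax⟩
      exact ⟨⟨x, hxI, hax⟩, ⟨x, hxJ, hax⟩⟩
    · rintro a ⟨⟨x, hx, hax⟩, ⟨y, hy, hay⟩⟩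
      exact ⟨x ⊓ y, ⟨I.mem_of_le inf_le_left hx, J.mem_of_le inf_le_right hy⟩,
        T.compat.inf_right _ _ _ hax hay⟩
  scott := by
    intro D hne hD J hJ
    constructor
    · rintro _ ⟨I, hI, rfl⟩ a ⟨x, hx, hax⟩
      exact ⟨x, hJ.1 hI hx, hax⟩
    · rintro K hK a ⟨x, hx, hax⟩
      obtain ⟨I, hI, hxI⟩ := mem_of_isLUB hne hD hJ hx
      exact hK ⟨I, hI, rfl⟩ ⟨x, hxI, hax⟩

end RoundIdeal

/-- The contravariant functor `RI : SubS5^S → KRFrm^P`, sending `B` to its frame of round ideals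
and `T` to `I ↦ T⁻¹[I]`. -/
def RI : SubS5S.{u}ᵒᵖ ⥤ KRFrmP.{u} where
  obj B :=
    { carrier := RoundIdeal B.unop
      compact := RoundIdeal.isCompactElement_top
      regular := RoundIdeal.regular }
  map T := RoundIdeal.preimageHom T.unop
  map_id B := by
    refine PreframeHom.ext (funext fun I => le_antisymm ?_ ?_)
    · rintro a ⟨b, hb, hab⟩
      exact RoundIdeal.mem_of_le I (B.unop.isS5.le_of_rel a b hab) hb
    · intro a ha
      exact RoundIdeal.round I ha
  map_comp T U := by
    refine PreframeHom.ext (funext fun I => le_antisymm ?_ ?_)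
    · rintro a ⟨c, hc, b, hab, hbc⟩
      exact ⟨b, ⟨c, hc, hbc⟩, hab⟩
    · rintro a ⟨b, ⟨c, hc, hbc⟩, hab⟩
      exact ⟨c, hc, b, hab, hbc⟩

/-! The booleanization functor -/

section WellInside

variable {L : Type*} [Order.Frame L]

theorem WellInside.le {a b : L} (h : WellInside a b) : a ≤ b :=
  calc a = a ⊓ (aᶜ ⊔ b) := by rw [show aᶜ ⊔ b = ⊤ from h, inf_top_eq]
    _ ≤ b := by rw [inf_sup_left, inf_compl_self, bot_sup_eq]; exact inf_le_right

theorem WellInside.mono {a b c d : L} (hab : a ≤ b) (h : WellInside b c) (hcd : c ≤ d) :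
    WellInside a d :=
  top_le_iff.1 ((show bᶜ ⊔ c = ⊤ from h) ▸ sup_le_sup (compl_le_compl hab) hcd)

theorem WellInside.sup {a b c : L} (ha : WellInside a c) (hb : WellInside b c) :
    WellInside (a ⊔ b) c := by
  unfold WellInside at *
  rw [compl_sup, sup_inf_right, ha, hb, inf_top_eq]

theorem WellInside.inf {a b c : L} (hb : WellInside a b) (hc : WellInside a c) :
    WellInside a (b ⊓ c) := by
  unfold WellInside at *
  rw [sup_inf_left, hb, hc, inf_top_eq]

theorem WellInside.compl_compl {a b : L} (h : WellInside a b) : WellInside aᶜᶜ b := by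
  unfold WellInside at *
  rwa [compl_compl_compl]

theorem wellInside_bot (b : L) : WellInside ⊥ b := by simp [WellInside]

theorem wellInside_top (a : L) : WellInside a ⊤ := by simp [WellInside]

/-- Compactness: `b ≺ ⋁ D` with `D` directed gives `b ≺ d` for some `d ∈ D`. -/
theorem WellInside.exists_of_isLUB (hL : IsCompactElement (⊤ : L)) {D : Set L}
    (hne : D.Nonempty) (hD : DirectedOn (· ≤ ·) D) {m b : L} (hm : IsLUB D m)
    (h : WellInside b m) : ∃ d ∈ D, WellInside b d := by
  obtain ⟨_, ⟨d, hd, rfl⟩, htop⟩ := hL ((fun d => bᶜ ⊔ d) '' D) ⊤ (hne.image _)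
    (by
      rintro _ ⟨x, hx, rfl⟩ _ ⟨y, hy, rfl⟩
      obtain ⟨z, hz, hxz, hyz⟩ := hD x hx y hy
      exact ⟨_, ⟨z, hz, rfl⟩, sup_le_sup_left hxz _, sup_le_sup_left hyz _⟩)
    (by
      refine ⟨fun _ _ => le_top, fun w hw => ?_⟩
      rw [← show bᶜ ⊔ m = ⊤ from h]
      obtain ⟨x, hx⟩ := hne
      exact sup_le (le_sup_left.trans (hw ⟨x, hx, rfl⟩))
        (hm.2 fun d hd => le_sup_right.trans (hw ⟨d, hd, rfl⟩)))
    le_rfl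
  exact ⟨d, hd, top_le_iff.1 htop⟩

end WellInside

namespace KRFrmP

variable (L : KRFrmP.{u})

/-- The regular elements well-inside `a`. -/
def approx (a : L.carrier) : Set L.carrier := {c | Heyting.IsRegular c ∧ WellInside c a}

theorem approx_nonempty (a : L.carrier) : (L.approx a).Nonempty :=
  ⟨⊥, Heyting.isRegular_bot, wellInside_bot a⟩

theorem approx_directed (a : L.carrier) : DirectedOn (· ≤ ·) (L.approx a) := by
  rintro x ⟨_, hx⟩ y ⟨_, hy⟩
  exact ⟨(x ⊔ y)ᶜᶜ, ⟨Heyting.isRegular_compl _, (hx.sup hy).compl_compl⟩,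
    le_sup_left.trans le_compl_compl, le_sup_right.trans le_compl_compl⟩

theorem isLUB_approx (a : L.carrier) : IsLUB (L.approx a) a := by
  refine ⟨fun c hc => hc.2.le, fun w hw => ?_⟩
  rw [L.regular a]
  exact sSup_le fun x hx =>
    le_compl_compl.trans (hw ⟨Heyting.isRegular_compl _, WellInside.compl_compl hx⟩)

theorem exists_between {a b : L.carrier} (h : WellInside a b) :
    ∃ c : Heyting.Regular L.carrier, WellInside a c ∧ WellInside (c : L.carrier) b := by
  obtain ⟨c, ⟨hc, hcb⟩, hac⟩ :=
    h.exists_of_isLUB L.compact (L.approx_nonempty b) (L.approx_directed b) (L.isLUB_approx b)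
  exact ⟨⟨c, hc⟩, hac, hcb⟩

theorem exists_map {L M : KRFrmP.{u}} (f : L ⟶ M) {a : L.carrier} {b : M.carrier}
    (h : WellInside b (f.toFun a)) :
    ∃ c : Heyting.Regular L.carrier, WellInside (c : L.carrier) a ∧
      WellInside b (f.toFun c) := by
  obtain ⟨_, ⟨c, ⟨hc, hca⟩, rfl⟩, hbc⟩ :=
    h.exists_of_isLUB M.compact ((L.approx_nonempty a).image _)
      (by
        rintro _ ⟨x, hx, rfl⟩ _ ⟨y, hy, rfl⟩
        obtain ⟨z, hz, hxz, hyz⟩ := L.approx_directed a x hx y hy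
        exact ⟨_, ⟨z, hz, rfl⟩, f.scott.monotone hxz, f.scott.monotone hyz⟩)
      (f.scott (L.approx_nonempty a) (L.approx_directed a) (L.isLUB_approx a))
  exact ⟨⟨c, hc⟩, hca, hbc⟩

/-- The booleanization `{a | a = a**}` of a compact regular frame, with the restriction of the
well-inside relation. -/
def booleanization : SubS5S.{u} where
  carrier := Heyting.Regular L.carrier
  rel a b := WellInside (a : L.carrier) (b : L.carrier)
  isS5 :=
    { bot_bot := wellInside_bot _
      top_top := wellInside_top _
      sup_left := fun a b c ha hb => by
        rw [Heyting.Regular.coe_sup]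
        exact (WellInside.sup ha hb).compl_compl
      inf_right := fun _ (c : Heyting.Regular L.carrier) d hc hd => by
        change WellInside _ ((c ⊓ d : Heyting.Regular L.carrier) : L.carrier)
        rw [Heyting.Regular.coe_inf]
        exact WellInside.inf hc hd
      mono := fun a b c d hab h hcd => WellInside.mono hab h hcd
      le_of_rel := fun a b h => WellInside.le h
      compl_rel := fun a b h => by
        unfold WellInside at *
        rw [Heyting.Regular.coe_compl, Heyting.Regular.coe_compl, b.prop.eq, sup_comm]
        exact h
      exists_between := fun a b h => L.exists_between h }

theorem isDeVries_booleanization : IsDeVries L.booleanization := by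
  constructor
  · intro (a : Heyting.Regular L.carrier) ha
    by_contra! hcon
    refine ha (Heyting.Regular.coe_injective (le_bot_iff.1 ?_))
    refine (L.isLUB_approx (a : L.carrier)).2 fun c hc => ?_
    by_contra hne
    refine hcon (⟨c, hc.1⟩ : Heyting.Regular L.carrier) (fun h => hne ?_) hc.2
    exact (congrArg Heyting.Regular.val h).le
  · intro (s : Set (Heyting.Regular L.carrier))
    refine ⟨Heyting.Regular.toRegular (sSup (Heyting.Regular.val '' s)), ?_, ?_⟩
    · intro a ha
      exact (le_sSup (Set.mem_image_of_mem _ ha)).trans le_compl_compl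
    · intro (w : Heyting.Regular L.carrier) hw
      have h : sSup (Heyting.Regular.val '' s) ≤ (w : L.carrier) := by
        refine sSup_le ?_
        rintro _ ⟨a, ha, rfl⟩
        exact hw ha
      exact (compl_le_compl (compl_le_compl h)).trans w.prop.eq.le

end KRFrmP

/-- The compatible subordination `b ≺ □ a` between booleanizations. -/
def booleanizationHom {L M : KRFrmP.{u}} (f : L ⟶ M) :
    SubS5S.Hom M.booleanization L.booleanization where
  rel := fun (b : Heyting.Regular M.carrier) (a : Heyting.Regular L.carrier) =>
    WellInside (b : M.carrier) (f.toFun (a : L.carrier))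
  compat :=
    { bot_bot := wellInside_bot _
      top_top := by
        change WellInside (⊤ : M.carrier) (f.toFun ⊤)
        rw [f.map_top]
        exact wellInside_top _
      sup_left := fun (a : Heyting.Regular M.carrier) (b : Heyting.Regular M.carrier) c ha hb => by
        change WellInside ((a ⊔ b : Heyting.Regular M.carrier) : M.carrier) _
        rw [Heyting.Regular.coe_sup]
        exact (WellInside.sup ha hb).compl_compl
      inf_right := fun a (c : Heyting.Regular L.carrier) (d : Heyting.Regular L.carrier) hc hd => by
        change WellInside _ (f.toFun ((c ⊓ d : Heyting.Regular L.carrier) : L.carrier))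
        rw [Heyting.Regular.coe_inf, f.map_inf]
        exact WellInside.inf hc hd
      mono := fun a b c d hab h hcd => WellInside.mono hab h (f.scott.monotone hcd)
      comp_right := by
        funext b a
        refine propext ⟨?_, fun h => ?_⟩
        · rintro ⟨c, hbc, hca⟩
          exact WellInside.mono le_rfl hbc (f.scott.monotone (WellInside.le hca))
        · obtain ⟨c, hca, hbc⟩ := KRFrmP.exists_map f h
          exact ⟨c, hbc, hca⟩
      comp_left := by
        funext b a
        refine propext ⟨?_, fun h => M.exists_between h⟩
        rintro ⟨c, hbc, hca⟩
        exact WellInside.mono (WellInside.le hbc) hca le_rfl }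

/-- The contravariant functor `𝔅 : KRFrm^P → DeV^S`, sending `L` to its booleanization with the
well-inside relation and `□ : L → M` to the relation `b 𝔅(□) a ↔ b ≺ □ a`. -/
def 𝔅 : KRFrmP.{u}ᵒᵖ ⥤ DeVS.{u} where
  obj L := ⟨L.unop.booleanization, L.unop.isDeVries_booleanization⟩
  map f := ObjectProperty.homMk (booleanizationHom f.unop)
  map_id L := rfl
  map_comp f g := by
    refine ObjectProperty.hom_ext _ (SubS5S.Hom.ext ?_)
    funext c a
    refine propext ⟨fun h => ?_, ?_⟩
    · obtain ⟨b, hb, hcb⟩ := KRFrmP.exists_map f.unop h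
      exact ⟨b, hcb, hb⟩
    · rintro ⟨b, hcb, hba⟩
      exact WellInside.mono le_rfl hcb (f.unop.scott.monotone (WellInside.le hba))

/-- The MacNeille completion functor `NI = 𝔅 ∘ RI : SubS5^S ⥤ DeV^S`. -/
def NI : SubS5S.{u} ⥤ DeVS.{u} := RI.rightOp ⋙ 𝔅

end S5Sub

open CategoryTheory S5Sub

/-! Two natural isomorphisms carry everything. For an S5-subordination algebra `B`, the relation `a
∈ J` between `B` and the regular round ideals is invertible, with inverse `J ≺ below b`.
Isomorphisms in `SubS5^S` are relations whose composites are the subordinations themselves, so they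
need not come from bijections; this is how an incomplete `B` can be isomorphic to a de Vries algebra
(`isoBooleanization`, `unitIso`). For a compact regular `L`, the map sending `a` to the regular
elements well-inside `a` is an order isomorphism onto the round ideals of the booleanization, with
inverse the join in `L` (`orderIsoRoundIdeal`, `counitIso`).

Both rest on one approximation principle: an ideal is a directed join of ideals `below b`, an
element of `L` a directed join of regular elements well-inside it, and compactness makes `≺` factor
through a member of such a join. The statements about `DeV^S` then follow because `Δ` is fully
faithful and every booleanization is de Vries. -/

namespace S5Sub

/-! ### An S5-subordination algebra and the booleanization of its round ideals. -/

namespace RoundIdeal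

variable {B : SubS5S.{u}}

theorem below_le {I : RoundIdeal B} {b : B.carrier} (hb : b ∈ I) : below b ≤ I :=
  fun a ha => I.mem_of_le (B.isS5.le_of_rel a b ha) hb

/-- The round ideals `below b` with `b ∈ I` approximate `I` from below. -/
theorem isLUB_image_below (I : RoundIdeal B) : IsLUB (below '' {b | b ∈ I}) I := by
  refine ⟨?_, fun J hJ a ha => ?_⟩
  · rintro _ ⟨b, hb, rfl⟩
    exact below_le hb
  · obtain ⟨b, hb, hab⟩ := I.round ha
    exact hJ ⟨b, hb, rfl⟩ hab

theorem directedOn_image_below (I : RoundIdeal B) :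
    DirectedOn (· ≤ ·) (below '' {b | b ∈ I}) := by
  rintro _ ⟨b, hb, rfl⟩ _ ⟨c, hc, rfl⟩
  exact ⟨_, ⟨b ⊔ c, I.sup_mem hb hc, rfl⟩,
    fun _ h => B.isS5.mono _ _ _ _ le_rfl h le_sup_left,
    fun _ h => B.isS5.mono _ _ _ _ le_rfl h le_sup_right⟩

/-- Compactness of the frame of round ideals, applied to `I` as the directed join of the `below b`.
This supplies the interpolant `b` needed whenever `belowHom` is composed with another relation. -/
theorem exists_wellInside_below {J I : RoundIdeal B} (h : WellInside J I) :
    ∃ b ∈ I, WellInside J (below b) := by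
  obtain ⟨_, ⟨b, hb, rfl⟩, hJ⟩ := h.exists_of_isLUB isCompactElement_top
    (Set.Nonempty.image _ ⟨⊥, I.bot_mem⟩) I.directedOn_image_below I.isLUB_image_below
  exact ⟨b, hb, hJ⟩

/-- Every element of a round ideal `I` lies in a regular round ideal well-inside `I`. -/
theorem exists_regular_wellInside {I : RoundIdeal B} {a : B.carrier} (ha : a ∈ I) :
    ∃ J : Heyting.Regular (RoundIdeal B), a ∈ (J : RoundIdeal B) ∧
      WellInside (J : RoundIdeal B) I := by
  obtain ⟨b, hb, hab⟩ := I.round ha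
  -- Double pseudocomplementation makes `below b` regular and keeps it well-inside `I`, since `≺`
  -- depends on its left argument only through the pseudocomplement.
  exact ⟨⟨(below b)ᶜᶜ, Heyting.isRegular_compl _⟩,
    (le_compl_compl : below b ≤ _) hab, (wellInside_below hb).compl_compl⟩

/-- The compatible subordination `a ∈ J` from `B` to the booleanization of its frame of
round ideals. -/
def memHom (B : SubS5S.{u}) : B ⟶ (RI.obj (.op B)).booleanization where
  rel a (J : Heyting.Regular (RoundIdeal B)) := a ∈ (J : RoundIdeal B)
  compat :=
    { bot_bot := bot_mem _
      top_top := mem_top _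
      sup_left := fun _ _ J ha hb => sup_mem (Heyting.Regular.val J) ha hb
      inf_right := fun _ _ _ hc hd => ⟨hc, hd⟩
      mono := fun _ _ (J : Heyting.Regular (RoundIdeal B)) (K : Heyting.Regular (RoundIdeal B))
        hab hb hJK => (show (J : RoundIdeal B) ≤ K from hJK) (mem_of_le _ hab hb)
      comp_right := by
        funext a K
        refine propext ⟨?_, fun h => ?_⟩
        · rintro ⟨J, haJ, hJK⟩
          exact WellInside.le hJK haJ
        · exact exists_regular_wellInside h
      comp_left := by
        funext a K
        refine propext ⟨?_, fun h => ?_⟩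
        · rintro ⟨b, hab, hb⟩
          exact mem_of_le _ (B.isS5.le_of_rel _ _ hab) hb
        · obtain ⟨b, hb, hab⟩ := round _ h
          exact ⟨b, hab, hb⟩ }

/-- The compatible subordination `J ≺ below b` from the booleanization of the frame of round
ideals of `B` to `B`. -/
def belowHom (B : SubS5S.{u}) : (RI.obj (.op B)).booleanization ⟶ B where
  rel (J : Heyting.Regular (RoundIdeal B)) b := WellInside (J : RoundIdeal B) (below b)
  compat :=
    { bot_bot := wellInside_bot _
      top_top := by
        have h : below (⊤ : B.carrier) = ⊤ :=
          top_le_iff.1 fun _ _ => B.isS5.mono _ _ _ _ le_top B.isS5.top_top le_rfl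
        change WellInside _ (below (⊤ : B.carrier))
        rw [h]
        exact wellInside_top _
      sup_left := fun (J : Heyting.Regular (RoundIdeal B)) (K : Heyting.Regular (RoundIdeal B))
        c hJ hK => by
        change WellInside ((J ⊔ K : Heyting.Regular (RoundIdeal B)) : RoundIdeal B) _
        rw [Heyting.Regular.coe_sup]
        exact (WellInside.sup hJ hK).compl_compl
      inf_right := fun J c d hc hd =>
        WellInside.mono le_rfl (WellInside.inf hc hd) fun _ h => B.isS5.inf_right _ _ _ h.1 h.2
      mono := fun _ _ _ _ hJK h hcd =>
        WellInside.mono hJK h fun _ h => B.isS5.mono _ _ _ _ le_rfl h hcd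
      comp_right := by
        funext J b
        refine propext ⟨?_, fun h => ?_⟩
        · rintro ⟨c, hJc, hcb⟩
          exact WellInside.mono le_rfl hJc (below_le hcb)
        · obtain ⟨c, hc, hJ⟩ := exists_wellInside_below h
          exact ⟨c, hJ, hc⟩
      comp_left := by
        funext J b
        refine propext ⟨?_, fun h => (RI.obj (.op B)).exists_between h⟩
        rintro ⟨K, hJK, hKb⟩
        exact WellInside.mono (WellInside.le hJK) hKb le_rfl }

/-- Every S5-subordination algebra is isomorphic in `SubS5^S` to the booleanization of its frame
of round ideals. -/
def isoBooleanization (B : SubS5S.{u}) : B ≅ (RI.obj (.op B)).booleanization where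
  hom := memHom B
  inv := belowHom B
  hom_inv_id := by
    refine SubS5S.Hom.ext (funext fun a => funext fun b => propext ⟨?_, fun h => ?_⟩)
    · rintro ⟨J, haJ, hJb⟩
      exact WellInside.le hJb haJ
    -- `a S b` means `a ∈ below b`, so roundness of `below b` yields the intermediate regular ideal.
    · exact exists_regular_wellInside (I := below b) h
  inv_hom_id := by
    refine SubS5S.Hom.ext (funext fun J => funext fun K => propext ⟨?_, fun h => ?_⟩)
    · rintro ⟨b, hJb, hbK⟩
      exact WellInside.mono le_rfl hJb (below_le hbK)
    · obtain ⟨b, hb, hJ⟩ := exists_wellInside_below h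
      exact ⟨b, hJ, hb⟩

end RoundIdeal

/-- `Δ ∘ 𝔅 ∘ RI` is naturally isomorphic to the identity of `SubS5^S`. -/
def unitIso : 𝟭 SubS5S.{u} ≅ RI.rightOp ⋙ 𝔅 ⋙ Δ :=
  NatIso.ofComponents RoundIdeal.isoBooleanization fun {B₁ B₂} T => by
    -- Both sides of the naturality square amount to `a ∈ T⁻¹[K]`: one directly, the other through a
    -- regular ideal well-inside `T⁻¹[K]`.
    refine SubS5S.Hom.ext (funext fun a => funext fun K => propext ⟨?_, ?_⟩)
    · rintro ⟨b, hab, hbK⟩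
      exact RoundIdeal.exists_regular_wellInside
        (show a ∈ RoundIdeal.preimage T (Heyting.Regular.val K) from ⟨b, hbK, hab⟩)
    · rintro ⟨J, haJ, hJK⟩
      obtain ⟨b, hb, hab⟩ := WellInside.le hJK haJ
      exact ⟨b, hab, hb⟩

/-! ### A compact regular frame and the round ideals of its booleanization. -/

/-- An order isomorphism between frames as a preframe homomorphism. -/
def PreframeHom.ofOrderIso {L M : Type*} [Order.Frame L] [Order.Frame M] (e : L ≃o M) :
    PreframeHom L M where
  toFun := e
  map_top := e.map_top
  map_inf := e.map_inf
  scott _ _ _ _ h := e.isLUB_image'.2 h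

namespace KRFrmP

/-- Order isomorphisms are isomorphisms in `KRFrm^P`. -/
def isoOfOrderIso {L M : KRFrmP.{u}} (e : L.carrier ≃o M.carrier) : L ≅ M where
  hom := PreframeHom.ofOrderIso e
  inv := PreframeHom.ofOrderIso e.symm
  hom_inv_id := PreframeHom.ext (funext e.symm_apply_apply)
  inv_hom_id := PreframeHom.ext (funext e.apply_symm_apply)

variable (L : KRFrmP.{u})

/-- The round ideal of the regular elements well-inside `a`. -/
def approxIdeal (a : L.carrier) : RoundIdeal L.booleanization :=
  .mk' {c : Heyting.Regular L.carrier | WellInside (c : L.carrier) a} (wellInside_bot a)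
    (fun (b : Heyting.Regular L.carrier) hb (c : Heyting.Regular L.carrier) hc => by
      change WellInside ((b ⊔ c : Heyting.Regular L.carrier) : L.carrier) a
      rw [Heyting.Regular.coe_sup]
      exact (WellInside.sup hb hc).compl_compl)
    (fun _ _ h hb => WellInside.mono h hb le_rfl)
    (fun _ ha => by
      obtain ⟨c, hac, hcb⟩ := L.exists_between ha
      exact ⟨c, hcb, hac⟩)

/-- The elements of `L` underlying a round ideal of its booleanization. -/
def underlying (I : RoundIdeal L.booleanization) : Set L.carrier :=
  Heyting.Regular.val '' {c : Heyting.Regular L.carrier | (c : L.booleanization.carrier) ∈ I}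

theorem directedOn_underlying (I : RoundIdeal L.booleanization) :
    DirectedOn (· ≤ ·) (L.underlying I) := by
  rintro _ ⟨b, hb, rfl⟩ _ ⟨c, hc, rfl⟩
  -- This join is that of the booleanization, the double pseudocomplement of the join in `L`; it is
  -- still an upper bound in `L`.
  refine ⟨_, ⟨b ⊔ c, I.sup_mem hb hc, rfl⟩, ?_, ?_⟩
  · exact (le_sup_left : b ≤ b ⊔ c)
  · exact (le_sup_right : c ≤ b ⊔ c)

/-- The join is taken in `L`. Since `I` is directed, compactness turns `c ≺ ⋁ I` into `c ≺ d` for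
some `d ∈ I`; roundness of `I` gives the converse. -/
theorem approxIdeal_sSup (I : RoundIdeal L.booleanization) :
    L.approxIdeal (sSup (L.underlying I)) = I := by
  refine le_antisymm (fun c hc => ?_) (fun c hc => ?_)
  · obtain ⟨_, ⟨d, hd, rfl⟩, hcd⟩ := WellInside.exists_of_isLUB L.compact
      (Set.Nonempty.image _ ⟨⊥, I.bot_mem⟩) (L.directedOn_underlying I) (isLUB_sSup _) hc
    exact I.mem_of_le (WellInside.le hcd) hd
  · obtain ⟨d, hd, hcd⟩ := I.round hc
    exact WellInside.mono le_rfl hcd (le_sSup ⟨d, hd, rfl⟩)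

theorem underlying_approxIdeal (a : L.carrier) : L.underlying (L.approxIdeal a) = L.approx a := by
  ext c
  exact ⟨fun ⟨d, hd, h⟩ => h ▸ ⟨d.prop, hd⟩, fun h => ⟨⟨c, h.1⟩, h.2, rfl⟩⟩

/-- A compact regular frame is isomorphic to the frame of round ideals of its booleanization. -/
def orderIsoRoundIdeal : L.carrier ≃o RoundIdeal L.booleanization where
  toFun := L.approxIdeal
  invFun I := sSup (L.underlying I)
  left_inv a := by
    change sSup (L.underlying (L.approxIdeal a)) = a
    rw [underlying_approxIdeal]
    exact (L.isLUB_approx a).sSup_eq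
  right_inv := L.approxIdeal_sSup
  map_rel_iff' {a b} := by
    -- Order is reflected by regularity: `a` is the join of the regular elements well-inside it.
    refine ⟨fun h => (L.isLUB_approx a).2 fun c hc => ?_, fun h c hc => WellInside.mono le_rfl hc h⟩
    exact WellInside.le (h (show WellInside ((⟨c, hc.1⟩ : Heyting.Regular L.carrier) : L.carrier) a
      from hc.2))

end KRFrmP

/-- `RI ∘ Δ ∘ 𝔅` is naturally isomorphic to the identity of `KRFrm^P`. -/
def counitIso : 𝔅.{u}.rightOp ⋙ Δ.op ⋙ RI ≅ 𝟭 KRFrmP.{u} :=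
  (NatIso.ofComponents (F := 𝟭 KRFrmP.{u}) (G := 𝔅.{u}.rightOp ⋙ Δ.op ⋙ RI)
    (fun L => KRFrmP.isoOfOrderIso (M := RI.obj (.op L.booleanization)) L.orderIsoRoundIdeal)
    fun {L M} f => by
      -- Naturality says that `b ≺ f a` iff `b ≺ f c` for some regular `c ≺ a`; the forward
      -- direction uses that `f` preserves directed joins and that `M` is compact.
      refine PreframeHom.ext (funext fun a => le_antisymm (fun b hb => ?_) ?_)
      · obtain ⟨c, hca, hbc⟩ := KRFrmP.exists_map f hb
        exact ⟨c, hca, hbc⟩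
      · rintro b ⟨c, hca, hbc⟩
        exact WellInside.mono le_rfl hbc (f.scott.monotone (WellInside.le hca))).symm

/-! ### Transfer to de Vries algebras and the equivalences. -/

/-- `𝔅 ∘ RI ∘ Δ` is naturally isomorphic to the identity of `DeV^S`. -/
noncomputable def deVriesIso : Δ.{u} ⋙ RI.rightOp ⋙ 𝔅 ≅ 𝟭 DeVS.{u} :=
  -- The isomorphism already exists in `SubS5^S` between de Vries algebras, and fullness of the
  -- subcategory lifts it.
  Functor.fullyFaithfulCancelRight Δ (Functor.isoWhiskerLeft Δ unitIso.symm)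

end S5Sub

open CategoryTheory S5Sub
theorem mainTheorem2 :
    (∃ e : SubS5S.{u}ᵒᵖ ≌ KRFrmP.{u},
      e.functor = RI ∧ e.inverse = (𝔅 ⋙ Δ).rightOp) ∧
    (∃ e : DeVS.{u}ᵒᵖ ≌ KRFrmP.{u},
      e.functor = Δ.op ⋙ RI ∧ e.inverse = 𝔅.rightOp) ∧
    (∃ e : SubS5S.{u} ≌ DeVS.{u}, e.functor = NI ∧ e.inverse = Δ) ∧
    Nonempty (RI.{u}.rightOp ⋙ 𝔅 ≅ NI) ∧
    Nonempty (RI.{u}.rightOp ⋙ 𝔅 ⋙ Δ ≅ 𝟭 SubS5S.{u}) ∧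
    Nonempty (Δ.{u} ⋙ RI.rightOp ⋙ 𝔅 ≅ 𝟭 DeVS.{u}) ∧
    Nonempty (𝔅.{u}.rightOp ⋙ Δ.op ⋙ RI ≅ 𝟭 KRFrmP.{u}) ∧
    Nonempty (Δ.{u}.op ⋙ RI ⋙ 𝔅.rightOp ≅ 𝟭 DeVS.{u}ᵒᵖ) ∧
    Nonempty (NI.{u} ⋙ Δ ≅ 𝟭 SubS5S.{u}) ∧
    Nonempty (Δ.{u} ⋙ NI ≅ 𝟭 DeVS.{u}) := by
  have deVriesOpIso : Δ.{u}.op ⋙ RI ⋙ 𝔅.rightOp ≅ 𝟭 DeVS.{u}ᵒᵖ := (NatIso.op deVriesIso).symm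
  -- `Equivalence.mk` corrects only the unit to obtain the triangle identity, so the functors are
  -- kept and `rfl` identifies them.
  exact ⟨⟨.mk RI (𝔅 ⋙ Δ).rightOp (NatIso.op unitIso.symm) counitIso, rfl, rfl⟩,
    ⟨.mk (Δ.op ⋙ RI) 𝔅.rightOp deVriesOpIso.symm counitIso, rfl, rfl⟩,
    ⟨.mk NI Δ unitIso deVriesIso, rfl, rfl⟩,
    ⟨Iso.refl _⟩, ⟨unitIso.symm⟩, ⟨deVriesIso⟩, ⟨counitIso⟩, ⟨deVriesOpIso⟩, ⟨unitIso.symm⟩,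
    ⟨deVriesIso⟩⟩
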